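/- Let $\mathcal H=\mathcal H_1\otimes\mathcal H_2$ be a tensor product of finite-dimensional complex Hilbert spaces, let $\rho,\sigma$ be states on $\mathcal H$ (positive semidefinite operators of trace one), and put $\rho_1=\mathrm{Tr}_2\,\rho$, $\sigma_1=\mathrm{Tr}_2\,\sigma$. Let $K=K_1\otimes V$ with $K_1$ an operator on $\mathcal H_1$ and $V$ a unitary on $\mathcal H_2$. For a positive semidefinite $X$ with spectral projections $P_\lambda$ and $\beta\in\mathbb C$ put $X^\beta=\sum_{\lambda\neq0}\lambda^\beta P_\lambda$ (so $X^{-1}$ is the generalized inverse). Operators on $\mathcal H_1$ are identified with $X\otimes I$ on $\mathcal H$. Let $\Delta_{\sigma,\rho}(X)=\sigma X\rho^{-1}$, a positive semidefinite operator for the inner product $\mathrm{Tr}(X^*Y)$, and $$S_f^K(\rho\|\sigma)=\mathrm{Tr}\big(\rho^{1/2}K^*f(\Delta_{\sigma,\rho})(K\rho^{1/2})\big).$$ Let $f:(0,\infty)\to\mathbb R$ be a regular operator monotone decreasing function; that is, $f$ is operator monotone decreasing, with canonical representation $$f(x)=ax+b+\int_0^\infty\Big(\frac1{t+x}-\frac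 t{t^2+1}\Big)\,d\mu(t),\qquad x>0,$$ where $a\le0$, $b\in\mathbb R$ and $\mu$ is a positive measure on $(0,\infty)$ with $\int_0^\infty\frac{d\mu(t)}{t^2+1}<\infty$; moreover $\mu$ is absolutely continuous with respect to Lebesgue measure, and for all $S,T>0$ there is a finite constant $C$ with $dt\le C\,d\mu(t)$ on $[1/S,T]$. Assume that $K$ maps the range of $\rho$ into the range of $\sigma$. (This is automatic if $\sigma$ is invertible; it makes the entropies well defined, since then only the values of $f$ on $(0,\infty)$ enter, whatever value is assigned to $f(0)$.) (i) If $\rho$ is invertible, then $S_f^K(\rho\|\sigma)=S_f^{K_1}(\rho_1\|\sigma_1)$ if and only if $$\sigma_1^{\beta}K\rho_1^{-\beta}=\sigma^{\beta}K\rho^{-\beta}\qquad\text{for all }\beta\in\mathbb C.$$ (ii) For every $\rho$, invertible or not, $S_f^K(\rho\|\sigma)=S_f^{K_1}(\rho_1\|\sigma_1)$ if and only if $$\sigma_1^{\beta}K\rho_1^{-\beta}\rho^{1/2}=\sigma^{\beta}K\rho^{1/2-\beta}\qquad\text{for all }\beta\in\mathbb C.$$ -/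

import Mathlib

open scoped Kronecker ComplexOrder

noncomputable section

namespace QuasiEntropy

open Matrix MeasureTheory

/-- A state on `ℂ^n`: a positive semidefinite operator of trace one. -/
def IsState {n : Type*} [Fintype n] (ρ : Matrix n n ℂ) : Prop :=
  ρ.PosSemidef ∧ ρ.trace = 1

/-- The partial trace over the second factor of `ℂ^m ⊗ ℂ^n`. -/
def ptrace₂ {m n : Type*} [Fintype n] (X : Matrix (m × n) (m × n) ℂ) : Matrix m m ℂ :=
  Matrix.of fun i j => ∑ k, X (i, k) (j, k)

/-- The operator `g(A) = ∑ g(μ) P_μ` (sum over the spectrum of the self-adjoint matrix `A`,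
with spectral projections `P_μ`) for a complex valued function `g`, obtained from the
continuous functional calculus applied to the real and imaginary parts of `g`. -/
def fnC {n : Type*} [Fintype n] [DecidableEq n] (g : ℝ → ℂ) (A : Matrix n n ℂ) :
    Matrix n n ℂ :=
  cfc (fun x : ℝ => (g x).re) A + Complex.I • cfc (fun x : ℝ => (g x).im) A

/-- In a spectral decomposition of `A`, the operator `fnC g A` is diagonal with entries
`g(μ_i)`. -/
theorem fnC_eq {n : Type*} [Fintype n] [DecidableEq n] (g : ℝ → ℂ) {A : Matrix n n ℂ}
    (hA : A.IsHermitian) :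
    fnC g A = (hA.eigenvectorUnitary : Matrix n n ℂ) *
      diagonal (fun i => g (hA.eigenvalues i)) *
      star (hA.eigenvectorUnitary : Matrix n n ℂ) := by
  have hd : diagonal (fun i => g (hA.eigenvalues i)) =
      diagonal (fun i => (((g (hA.eigenvalues i)).re : ℝ) : ℂ)) +
        Complex.I • diagonal (fun i => (((g (hA.eigenvalues i)).im : ℝ) : ℂ)) := by
    rw [← diagonal_smul, diagonal_add]
    congr 1
    funext i
    simp only [Pi.smul_apply, smul_eq_mul]
    rw [mul_comm, Complex.re_add_im]
  rw [fnC, hA.cfc_eq, hA.cfc_eq, IsHermitian.cfc, IsHermitian.cfc, hd]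
  simp only [Unitary.conjStarAlgAut_apply, Function.comp_def, Matrix.mul_add, Matrix.add_mul,
    Matrix.mul_smul, Matrix.smul_mul]
  rfl

/-- Complex powers of a positive semidefinite matrix: `A ^ β = ∑ μ ^ β P_μ`, the sum running over
the non-zero eigenvalues `μ` of `A`. For `β = -1` this is the generalized inverse, for `β = 0` the
projection onto the range, and for invertible `A` it is the usual power. -/
def mpow {n : Type*} [Fintype n] [DecidableEq n] (A : Matrix n n ℂ) (β : ℂ) : Matrix n n ℂ :=
  fnC (fun x => if x = 0 then 0 else (x : ℂ) ^ β) A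

/-- The relative modular operator `Δ_{A,B} = L_A R_B⁻¹`, `X ↦ A X B⁻¹`, with the generalized inverse
of `B`. -/
def modularOp {n : Type*} [Fintype n] [DecidableEq n] (A B : Matrix n n ℂ) :
    Matrix n n ℂ →ₗ[ℂ] Matrix n n ℂ :=
  LinearMap.mulLeft ℂ A ∘ₗ LinearMap.mulRight ℂ (mpow B (-1))

/-- The operator `f(T)` for an operator `T` on the space of matrices that is self-adjoint for the
Hilbert–Schmidt inner product `⟪X, Y⟫ = Tr (X* Y)`: the functional calculus is applied to the matrix
of `T` in the matrix units, which are an orthonormal basis for this inner product. -/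
def superFn {n : Type*} [Fintype n] [DecidableEq n] (f : ℝ → ℝ)
    (T : Matrix n n ℂ →ₗ[ℂ] Matrix n n ℂ) : Matrix n n ℂ →ₗ[ℂ] Matrix n n ℂ :=
  Matrix.toLin (Matrix.stdBasis ℂ n n) (Matrix.stdBasis ℂ n n)
    (cfc f (LinearMap.toMatrix (Matrix.stdBasis ℂ n n) (Matrix.stdBasis ℂ n n) T))

/-- The modular operator of positive semidefinite matrices is positive semidefinite for the
Hilbert–Schmidt inner product, so that `superFn` applies to it. -/
theorem posSemidef_toMatrix_modularOp {n : Type*} [Fintype n] [DecidableEq n]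
    {A B : Matrix n n ℂ} (hA : A.PosSemidef) (hB : B.PosSemidef) :
    (LinearMap.toMatrix (Matrix.stdBasis ℂ n n) (Matrix.stdBasis ℂ n n)
      (modularOp A B)).PosSemidef := by
  have hinv : (mpow B (-1)).PosSemidef := by
    rw [mpow, fnC_eq _ hB.isHermitian]
    refine PosSemidef.mul_mul_conjTranspose_same (PosSemidef.diagonal fun i => ?_) _
    change (0 : ℂ) ≤ _
    split_ifs
    · exact le_rfl
    · rw [Complex.cpow_neg_one, ← Complex.ofReal_inv]
      exact_mod_cast inv_nonneg.mpr (hB.eigenvalues_nonneg i)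
  have hmat : LinearMap.toMatrix (Matrix.stdBasis ℂ n n) (Matrix.stdBasis ℂ n n) (modularOp A B) =
      A ⊗ₖ (mpow B (-1))ᵀ := by
    ext ⟨i, j⟩ ⟨k, l⟩
    rw [LinearMap.toMatrix_apply, Matrix.stdBasis_eq_single, kroneckerMap_apply, transpose_apply]
    simp [modularOp, Matrix.stdBasis, Matrix.mul_apply, Matrix.single_apply, ite_and]
  rw [hmat]
  exact hA.kronecker hinv.transpose

/-- The quasi-relative entropy `S_f^K(ρ‖σ) = Tr (√ρ K* f(Δ_{σ,ρ})(K √ρ))`. -/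
def quasiEntropy {n : Type*} [Fintype n] [DecidableEq n] (f : ℝ → ℝ) (K ρ σ : Matrix n n ℂ) : ℂ :=
  (mpow ρ (1 / 2) * Kᴴ * superFn f (modularOp σ ρ) (K * mpow ρ (1 / 2))).trace

/-- `f` is operator monotone decreasing on `(0, ∞)`: `A ≤ B` implies `f(B) ≤ f(A)` for
self-adjoint matrices of every size with spectrum in `(0, ∞)`. -/
def OperatorMonotoneDecreasing (f : ℝ → ℝ) : Prop :=
  ∀ (d : ℕ) (A B : Matrix (Fin d) (Fin d) ℂ), A.PosDef → B.PosDef →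
    (B - A).PosSemidef → (cfc f A - cfc f B).PosSemidef

/-- The canonical integral representation of an operator monotone decreasing function `f` on
`(0, ∞)`:
`f(x) = a x + b + ∫ (1 / (t + x) - t / (t² + 1)) dμ(t)` with `a ≤ 0` and a positive measure `μ` on
`(0, ∞)` such that `∫ 1 / (t² + 1) dμ(t) < ∞`. -/
structure IsCanonicalRep (f : ℝ → ℝ) (a b : ℝ) (μ : Measure ℝ) : Prop where
  nonpos : a ≤ 0
  support : μ (Set.Iic 0) = 0
  integrable : Integrable (fun t : ℝ => 1 / (t ^ 2 + 1)) μ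
  rep : ∀ x : ℝ, 0 < x → f x = a * x + b + ∫ t, (1 / (t + x) - t / (t ^ 2 + 1)) ∂μ

/-- A regular operator monotone decreasing function: the measure of its canonical representation is
absolutely continuous, and for all `S, T > 0` there is a finite constant `C` with `dt ≤ C dμ(t)` on
`[1/S, T]`. -/
def IsRegularFn (f : ℝ → ℝ) : Prop :=
  OperatorMonotoneDecreasing f ∧
    ∃ (a b : ℝ) (μ : Measure ℝ), IsCanonicalRep f a b μ ∧ μ ≪ volume ∧
      ∀ S T : ℝ, 0 < S → 0 < T → ∃ C : NNReal,
        volume.restrict (Set.Icc (1 / S) T) ≤ C • μ.restrict (Set.Icc (1 / S) T)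

end QuasiEntropy

end

open QuasiEntropy

namespace QuasiEntropy

open Matrix MeasureTheory

/-! ### Functional calculus of Hermitian matrices. -/

section FunctionalCalculus

variable {n m : Type*} [Fintype n] [DecidableEq n] [Fintype m] [DecidableEq m]

/-! Vectorizing matrices turns each entropy into a quadratic form of `f` at a positive semidefinite
matrix: `A = σ ⊗ (ρ⁻¹)ᵀ` at `Kρ^{1/2}`, and `B = σ₁ ⊗ (ρ₁⁻¹)ᵀ` at `w = K₁ρ₁^{1/2}`. The map `U : X ↦
(Xρ₁^{-1/2} ⊗ V)ρ^{1/2}` satisfies `U*U ≤ 1`, `U*AU ≤ B`, `U*Uw = w` and `Uw = Kρ^{1/2}`, so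
everything becomes a question about `A`, `B`, `U` and `w`.

For `t > 0` the difference `⟨Uw, (t+A)⁻¹Uw⟩ - ⟨w, (t+B)⁻¹w⟩` is at least `t‖(t+A)⁻¹Uw - U(t+B)⁻¹w‖²`
(`resolvent_gap`). The integral representation writes the difference of the entropies as a
nonnegative linear term plus the `μ`-integral of these differences. If the entropies agree, the
differences vanish `μ`-almost everywhere, hence for infinitely many `t` by regularity
(`IsRegularFn.exists_infinite_resolvent`). In each coordinate the resolvent identity is a rational
function of `t`, so it yields `g(A)Uw = U g(B)w` for every `g`, in particular for complex powers,
which are the stated identities. Conversely, the identities for powers give the one for `f` by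
interpolation on the finite spectra, and `U*Uw = w` gives equality of the entropies. The range
condition on `K` removes the eigenvalue `0`. -/

theorem cfc_eq_fnC (f : ℝ → ℝ) (A : Matrix n n ℂ) : cfc f A = fnC (fun x => (f x : ℂ)) A := by
  simp [fnC]

/-- Functions of a Hermitian matrix intertwine along with the matrix. -/
theorem fnC_intertwine (g : ℝ → ℂ) {A : Matrix n n ℂ} {B : Matrix m m ℂ} (hA : A.IsHermitian)
    (hB : B.IsHermitian) (X : Matrix n m ℂ) (h : A * X = X * B) :
    fnC g A * X = X * fnC g B := by
  rw [fnC_eq g hA, fnC_eq g hB]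
  have hAs := hA.spectral_theorem
  have hBs := hB.spectral_theorem
  rw [Unitary.conjStarAlgAut_apply] at hAs hBs
  set W := (hA.eigenvectorUnitary : Matrix n n ℂ)
  set Z := (hB.eigenvectorUnitary : Matrix m m ℂ)
  have hW : star W * W = 1 := Unitary.coe_star_mul_self _
  have hW' : W * star W = 1 := Unitary.coe_mul_star_self _
  have hZ : star Z * Z = 1 := Unitary.coe_star_mul_self _
  have hZ' : Z * star Z = 1 := Unitary.coe_mul_star_self _
  set a := hA.eigenvalues
  set b := hB.eigenvalues
  set Y := star W * X * Z with hY
  have hX : X = W * Y * star Z := by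
    rw [hY, show W * (star W * X * Z) * star Z = (W * star W) * X * (Z * star Z) by
      simp only [Matrix.mul_assoc], hW', hZ', Matrix.one_mul, Matrix.mul_one]
  have hd : diagonal (RCLike.ofReal ∘ a : n → ℂ) * Y = Y * diagonal (RCLike.ofReal ∘ b : m → ℂ) := by
    calc diagonal (RCLike.ofReal ∘ a : n → ℂ) * Y
        = (star W * W) * diagonal (RCLike.ofReal ∘ a : n → ℂ) * (star W * X * Z) := by
          rw [hW, Matrix.one_mul]
      _ = star W * (A * X) * Z := by rw [hAs]; simp only [Matrix.mul_assoc]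
      _ = star W * (X * B) * Z := by rw [h]
      _ = Y * diagonal (RCLike.ofReal ∘ b : m → ℂ) * (star Z * Z) := by
          rw [hBs]; simp only [hY, Matrix.mul_assoc]
      _ = _ := by rw [hZ, Matrix.mul_one]
  -- An entry `Y i j ≠ 0` forces `a i = b j`, hence equal values of `g`.
  have hg : diagonal (fun i => g (a i)) * Y = Y * diagonal (fun i => g (b i)) := by
    ext i j
    have hij := congrFun (congrFun hd i) j
    simp only [diagonal_mul, mul_diagonal, Function.comp_apply] at hij ⊢
    by_cases h0 : Y i j = 0
    · simp [h0]
    · rw [mul_comm] at hij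
      have : a i = b j := by exact_mod_cast mul_left_cancel₀ h0 hij
      rw [this, mul_comm]
  calc W * diagonal (fun i => g (a i)) * star W * X
      = W * (diagonal (fun i => g (a i)) * Y) * star Z := by
        rw [hX]
        simp only [Matrix.mul_assoc]
        rw [← Matrix.mul_assoc (star W) W, hW, Matrix.one_mul]
    _ = W * (Y * diagonal (fun i => g (b i))) * star Z := by rw [hg]
    _ = X * (Z * diagonal (fun i => g (b i)) * star Z) := by
        rw [hX]
        simp only [Matrix.mul_assoc]
        rw [← Matrix.mul_assoc (star Z) Z, hZ, Matrix.one_mul]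

/-- The eigenbasis in `fnC_eq` is unspecified, so the entries cannot be read off from it. Instead,
the `j`-th basis vector, as a one-column matrix, intertwines the diagonal matrix with the scalar `d
j`. -/
theorem fnC_diagonal (g : ℝ → ℂ) (d : n → ℝ) :
    fnC g (diagonal fun i => (d i : ℂ)) = diagonal fun i => g (d i) := by
  have hD : (diagonal fun i => (d i : ℂ)).IsHermitian := by
    rw [IsHermitian, diagonal_conjTranspose]
    congr 1
    funext i
    simp
  ext i j
  let v : Matrix n (Fin 1) ℂ := Matrix.of fun k _ => if k = j then 1 else 0
  let B : Matrix (Fin 1) (Fin 1) ℂ := Matrix.of fun _ _ => (d j : ℂ)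
  have hB : B.IsHermitian := by
    ext
    simp [B]
  have hBe : B = algebraMap ℝ _ (d j) := by
    ext a b
    fin_cases a; fin_cases b
    simp [B, Matrix.algebraMap_matrix_apply]
  have hBg : fnC g B = Matrix.of fun _ _ => g (d j) := by
    rw [hBe, fnC, cfc_algebraMap, cfc_algebraMap]
    ext a b
    fin_cases a; fin_cases b
    simp only [Matrix.add_apply, Matrix.smul_apply, Matrix.algebraMap_matrix_apply, of_apply]
    simp only [if_true, Complex.coe_algebraMap, smul_eq_mul]
    rw [mul_comm, Complex.re_add_im]
  have hv : (diagonal fun i => (d i : ℂ)) * v = v * B := by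
    ext k l
    by_cases hk : k = j <;> simp [Matrix.mul_apply, v, B, hk]
  have := congrFun (congrFun (fnC_intertwine g hD hB v hv) i) 0
  rw [hBg] at this
  simp only [Matrix.mul_apply, v, of_apply] at this
  simp only [mul_ite, mul_one, mul_zero, Finset.sum_ite_eq', Finset.mem_univ, if_true] at this
  rw [this, diagonal_apply]
  by_cases h : i = j <;> simp [h]

theorem fnC_mul (g h : ℝ → ℂ) {A : Matrix n n ℂ} (hA : A.IsHermitian) :
    fnC g A * fnC h A = fnC (fun x => g x * h x) A := by
  rw [fnC_eq g hA, fnC_eq h hA, fnC_eq _ hA, ← diagonal_mul_diagonal]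
  simp only [Matrix.mul_assoc]
  rw [← Matrix.mul_assoc (star _) (hA.eigenvectorUnitary : Matrix n n ℂ),
    Unitary.coe_star_mul_self, Matrix.one_mul]

theorem fnC_add (g h : ℝ → ℂ) {A : Matrix n n ℂ} (hA : A.IsHermitian) :
    fnC (fun x => g x + h x) A = fnC g A + fnC h A := by
  rw [fnC_eq g hA, fnC_eq h hA, fnC_eq _ hA, ← diagonal_add, Matrix.mul_add, Matrix.add_mul]

theorem fnC_congr {g h : ℝ → ℂ} {A : Matrix n n ℂ} (hA : A.PosSemidef)
    (H : ∀ x, 0 ≤ x → g x = h x) : fnC g A = fnC h A := by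
  rw [fnC_eq g hA.isHermitian, fnC_eq h hA.isHermitian]
  congr 3
  funext i
  exact H _ (hA.eigenvalues_nonneg i)

theorem fnC_id {A : Matrix n n ℂ} (hA : A.IsHermitian) : fnC (fun x => (x : ℂ)) A = A := by
  rw [← cfc_eq_fnC (fun x => x), cfc_id' ℝ A (by exact hA)]

theorem fnC_one {A : Matrix n n ℂ} (hA : A.IsHermitian) : fnC (fun _ => (1 : ℂ)) A = 1 := by
  rw [fnC_eq _ hA, diagonal_one, Matrix.mul_one]
  exact Unitary.coe_mul_star_self _

theorem fnC_conjTranspose (g : ℝ → ℂ) {A : Matrix n n ℂ} (hA : A.IsHermitian) :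
    (fnC g A)ᴴ = fnC (fun x => star (g x)) A := by
  rw [fnC_eq g hA, fnC_eq _ hA]
  simp only [conjTranspose_mul, star_eq_conjTranspose, conjTranspose_conjTranspose,
    diagonal_conjTranspose, Matrix.mul_assoc]
  rfl

/-- The quadratic form of `g(A)` at `v` is `∑ g(λ_i) |w_i|²`, where `w` are the coordinates of `v`
in the eigenbasis. -/
theorem star_dotProduct_fnC (g : ℝ → ℂ) {A : Matrix n n ℂ} (hA : A.IsHermitian) (v : n → ℂ) :
    star v ⬝ᵥ (fnC g A *ᵥ v) = ∑ i, g (hA.eigenvalues i) *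
      ((Complex.normSq ((star (hA.eigenvectorUnitary : Matrix n n ℂ) *ᵥ v) i) : ℝ) : ℂ) := by
  rw [fnC_eq g hA, ← mulVec_mulVec, ← mulVec_mulVec, dotProduct_mulVec, dotProduct]
  refine Finset.sum_congr rfl fun i _ => ?_
  have : (star v ᵥ* (hA.eigenvectorUnitary : Matrix n n ℂ)) i =
      star ((star (hA.eigenvectorUnitary : Matrix n n ℂ) *ᵥ v) i) := by
    rw [star_eq_conjTranspose, ← Pi.star_apply, star_mulVec, conjTranspose_conjTranspose]
  rw [this, mulVec_diagonal, Complex.normSq_eq_conj_mul_self]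
  simp only [RCLike.star_def]
  ring

/-- `g(A) v` is a linear combination, with coefficients the values of `g` at the eigenvalues, of
vectors independent of `g`. -/
theorem exists_fnC_mulVec_eq_sum {A : Matrix n n ℂ} (hA : A.IsHermitian) (v : n → ℂ) :
    ∃ u : n → n → ℂ, ∀ g : ℝ → ℂ, fnC g A *ᵥ v = ∑ i, g (hA.eigenvalues i) • u i := by
  refine ⟨fun i k => (hA.eigenvectorUnitary : Matrix n n ℂ) k i *
    (star (hA.eigenvectorUnitary : Matrix n n ℂ) *ᵥ v) i, fun g => ?_⟩
  ext k
  rw [fnC_eq g hA, ← mulVec_mulVec, ← mulVec_mulVec, Finset.sum_apply]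
  rw [mulVec, dotProduct]
  refine Finset.sum_congr rfl fun i _ => ?_
  rw [Pi.smul_apply, smul_eq_mul, mulVec_diagonal]
  ring

end FunctionalCalculus

/-! ### Functionals on finitely many nodes determined by resolvents or powers. -/

section Interpolation

/-- If `∑ c_i / (t + l_i)` vanishes for infinitely many `t > 0`, the functional
`g ↦ ∑ c_i g(l_i)` vanishes. -/
theorem sum_mul_eq_zero_of_resolvents {ι : Type*} [Fintype ι] (c : ι → ℂ) (l : ι → ℝ)
    (hl : ∀ i, 0 ≤ l i) (s : Set ℝ) (hs : s.Infinite) (hpos : ∀ t ∈ s, 0 < t)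
    (h : ∀ t ∈ s, ∑ i, c i * (1 / ((t : ℂ) + l i)) = 0) (g : ℝ → ℂ) :
    ∑ i, c i * g (l i) = 0 := by
  classical
  let Λ := Finset.univ.image l
  let C : ℝ → ℂ := fun x => ∑ i with l i = x, c i
  have key (φ : ℝ → ℂ) : ∑ i, c i * φ (l i) = ∑ x ∈ Λ, C x * φ x := by
    rw [← Finset.sum_fiberwise_of_maps_to (t := Λ) (g := l) (fun i _ => by simp [Λ])]
    refine Finset.sum_congr rfl fun x _ => ?_
    rw [Finset.sum_mul]
    refine Finset.sum_congr rfl fun i hi => ?_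
    rw [(Finset.mem_filter.mp hi).2]
  -- The sum of resolvents with denominators cleared. Equal nodes were merged into `C x`, so
  -- evaluation at `-x` isolates `C x` times a nonzero product.
  let p : Polynomial ℂ := ∑ x ∈ Λ, Polynomial.C (C x) *
    ∏ y ∈ Λ.erase x, (Polynomial.X + Polynomial.C (y : ℂ))
  have hp : p = 0 := by
    refine Polynomial.eq_zero_of_infinite_isRoot p
      ((hs.image (Complex.ofReal_injective.injOn)).mono ?_)
    rintro _ ⟨t, ht, rfl⟩
    have hΛ : ∀ x ∈ Λ, (t : ℂ) + x ≠ 0 := by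
      intro x hx
      obtain ⟨i, -, rfl⟩ := Finset.mem_image.mp hx
      have := hpos t ht
      have := hl i
      exact_mod_cast (by positivity : t + l i ≠ 0)
    have h0 := h t ht
    rw [key fun x => 1 / ((t : ℂ) + x)] at h0
    simp only [Set.mem_ofPred_eq, Polynomial.IsRoot, p, Polynomial.eval_finsetSum,
      Polynomial.eval_mul, Polynomial.eval_C, Polynomial.eval_prod, Polynomial.eval_add,
      Polynomial.eval_X]
    rw [← zero_mul (∏ y ∈ Λ, ((t : ℂ) + y)), ← h0, Finset.sum_mul]
    refine Finset.sum_congr rfl fun x hx => ?_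
    rw [← Finset.mul_prod_erase Λ _ hx]
    field_simp [hΛ x hx]
  rw [key]
  refine Finset.sum_eq_zero fun x hx => ?_
  have hx0 := congrArg (Polynomial.eval (-(x : ℂ))) hp
  simp only [p, Polynomial.eval_finsetSum, Polynomial.eval_mul, Polynomial.eval_C,
    Polynomial.eval_prod, Polynomial.eval_add, Polynomial.eval_X, Polynomial.eval_zero] at hx0
  rw [Finset.sum_eq_single x] at hx0
  · rcases mul_eq_zero.mp hx0 with h1 | h1
    · rw [h1, zero_mul]
    · obtain ⟨y, hy, hy0⟩ := Finset.prod_eq_zero_iff.mp h1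
      refine absurd ?_ (Finset.ne_of_mem_erase hy)
      have : (y : ℂ) = x := by linear_combination hy0
      exact_mod_cast this
  · intro y _ hyx
    refine mul_eq_zero_of_right _ (Finset.prod_eq_zero (i := x) ?_ (by simp))
    exact Finset.mem_erase.mpr ⟨hyx.symm, hx⟩
  · exact fun hn => absurd hx hn

/-- If the functional `g ↦ ∑ c_i g(l_i)` vanishes on the powers `x ^ k`, `k : ℕ`, set to zero at
`0`, it vanishes on every function that is zero at `0`. -/
theorem sum_mul_eq_zero_of_powers {ι : Type*} [Fintype ι] (c : ι → ℂ) (l : ι → ℝ)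
    (h : ∀ k : ℕ, ∑ i, c i * (if l i = 0 then 0 else (l i : ℂ) ^ k) = 0) (g : ℝ → ℂ) :
    ∑ i, c i * (if l i = 0 then 0 else g (l i)) = 0 := by
  classical
  let Λ := Finset.univ.image l
  let p := Lagrange.interpolate Λ (fun x : ℝ => (x : ℂ)) g
  have hp (i : ι) : g (l i) = ∑ k ∈ Finset.range (p.natDegree + 1), p.coeff k * (l i : ℂ) ^ k := by
    rw [← Polynomial.eval_eq_sum_range]
    exact (Lagrange.eval_interpolate_at_node g Complex.ofReal_injective.injOn
      (by simp [Λ])).symm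
  calc ∑ i, c i * (if l i = 0 then 0 else g (l i))
      = ∑ i, ∑ k ∈ Finset.range (p.natDegree + 1),
          p.coeff k * (c i * (if l i = 0 then 0 else (l i : ℂ) ^ k)) := by
        refine Finset.sum_congr rfl fun i _ => ?_
        split_ifs with h0
        · simp
        · rw [hp, Finset.mul_sum]
          exact Finset.sum_congr rfl fun k _ => by ring
    _ = 0 := by
        rw [Finset.sum_comm]
        refine Finset.sum_eq_zero fun k _ => ?_
        rw [← Finset.mul_sum, h, mul_zero]

end Interpolation

/-! ### Equality case of the monotonicity under a contraction. -/

section Equality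

theorem IsCanonicalRep.ae_pos {f : ℝ → ℝ} {a b : ℝ} {μ : Measure ℝ} (h : IsCanonicalRep f a b μ) :
    ∀ᵐ t ∂μ, 0 < t := by
  rw [ae_iff]
  convert h.support using 2
  ext
  simp

theorem IsCanonicalRep.integrable_kernel {f : ℝ → ℝ} {a b : ℝ} {μ : Measure ℝ}
    (h : IsCanonicalRep f a b μ) {x : ℝ} (hx : 0 < x) :
    Integrable (fun t : ℝ => 1 / (t + x) - t / (t ^ 2 + 1)) μ := by
  refine Integrable.mono' (h.integrable.const_mul (1 / x + x))
    (Measurable.aestronglyMeasurable (by fun_prop)) ?_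
  filter_upwards [h.ae_pos] with t ht
  -- The normalized kernel is `1 / (t² + 1)` times a factor bounded by `1/x + x` uniformly in `t >
  -- 0`.
  have e : 1 / (t + x) - t / (t ^ 2 + 1) = (1 - t * x) / (t + x) * (1 / (t ^ 2 + 1)) := by
    field_simp
    ring
  rw [e, norm_mul, Real.norm_eq_abs, Real.norm_eq_abs,
    abs_of_pos (show 0 < 1 / (t ^ 2 + 1) by positivity)]
  refine mul_le_mul_of_nonneg_right ?_ (by positivity)
  rw [abs_div, abs_of_pos (show 0 < t + x by positivity), div_le_iff₀ (by positivity)]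
  have e2 : (1 / x + x) * (t + x) = t / x + 1 + t * x + x ^ 2 := by
    field_simp
    ring
  have : 0 < t / x := by positivity
  have : 0 < t * x := by positivity
  rw [e2, abs_le]
  constructor <;> nlinarith [sq_nonneg x]

/-- For a regular function, an equality `∑ c_i f(l_i) = 0` between combinations that are ordered for
all resolvents forces equality for infinitely many resolvents. -/
theorem IsRegularFn.exists_infinite_resolvent {f : ℝ → ℝ} (hf : IsRegularFn f) {ι : Type*}
    [Fintype ι] (c l : ι → ℝ) (hl : ∀ i, 0 ≤ l i) (hc : ∀ i, l i = 0 → c i = 0)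
    (hsum : ∑ i, c i = 0) (hlin : ∑ i, c i * l i ≤ 0)
    (hres : ∀ t : ℝ, 0 < t → 0 ≤ ∑ i, c i * (1 / (t + l i)))
    (hzero : ∑ i, c i * f (l i) = 0) :
    ∃ s : Set ℝ, s.Infinite ∧ ∀ t ∈ s, 0 < t ∧ ∑ i, c i * (1 / (t + l i)) = 0 := by
  obtain ⟨-, a, b, μ, hrep, -, hreg⟩ := hf
  have hint (i : ι) : Integrable
      (fun t : ℝ => c i * (1 / (t + l i) - t / (t ^ 2 + 1))) μ := by
    rcases (hl i).eq_or_lt with h0 | h0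
    · simp [hc i h0.symm]
    · exact (hrep.integrable_kernel h0).const_mul _
  -- Since the weights sum to zero, the normalization `t / (t² + 1)` cancels, and so does the
  -- constant `b` below.
  have hker (t : ℝ) : ∑ i, c i * (1 / (t + l i) - t / (t ^ 2 + 1)) =
      ∑ i, c i * (1 / (t + l i)) := by
    simp only [mul_sub, Finset.sum_sub_distrib]
    rw [← Finset.sum_mul, hsum, zero_mul, sub_zero]
  have hterm (i : ι) : c i * f (l i) = a * (c i * l i) + b * c i +
      ∫ t, c i * (1 / (t + l i) - t / (t ^ 2 + 1)) ∂μ := by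
    rcases (hl i).eq_or_lt with h0 | h0
    · simp [hc i h0.symm]
    · rw [integral_const_mul, hrep.rep _ h0]
      ring
  have hD : ∑ i, c i * f (l i) = a * ∑ i, c i * l i +
      ∫ t, ∑ i, c i * (1 / (t + l i)) ∂μ := by
    simp only [← hker]
    rw [integral_finsetSum _ fun i _ => hint i]
    simp only [hterm, Finset.sum_add_distrib, ← Finset.mul_sum]
    rw [hsum, mul_zero, add_zero]
  have hDint : Integrable (fun t => ∑ i, c i * (1 / (t + l i))) μ := by
    simp only [← hker]
    exact integrable_finsetSum _ fun i _ => hint i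
  have hD0 : 0 ≤ᵐ[μ] fun t => ∑ i, c i * (1 / (t + l i)) := by
    filter_upwards [hrep.ae_pos] with t ht using hres t ht
  -- The linear term and the integral are both nonnegative and add up to zero.
  have hI : ∫ t, ∑ i, c i * (1 / (t + l i)) ∂μ = 0 := by
    have h1 := integral_nonneg_of_ae hD0
    have h2 := mul_nonneg_of_nonpos_of_nonpos hrep.nonpos hlin
    linarith
  have hae : ∀ᵐ t ∂μ, ∑ i, c i * (1 / (t + l i)) = 0 :=
    (integral_eq_zero_iff_of_nonneg_ae hD0 hDint).mp hI
  -- Any interval of positive length would do: on it, the domination turns `μ`-null sets into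
  -- Lebesgue-null sets.
  obtain ⟨C, hC⟩ := hreg 1 2 one_pos two_pos
  have hvol : ∀ᵐ t ∂(volume.restrict (Set.Icc (1 / 1 : ℝ) 2)),
      ∑ i, c i * (1 / (t + l i)) = 0 := by
    have : volume.restrict (Set.Icc (1 / 1 : ℝ) 2) ≪ μ :=
      ((Measure.absolutelyContinuous_of_le hC).trans
        Measure.smul_absolutelyContinuous).trans Measure.absolutelyContinuous_restrict
    exact this.ae_le hae
  refine ⟨{t | t ∈ Set.Icc (1 : ℝ) 2 ∧ ∑ i, c i * (1 / (t + l i)) = 0}, fun hfin => ?_,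
    fun t ht => ⟨one_pos.trans_le ht.1.1, ht.2⟩⟩
  rw [div_one, ae_restrict_iff' measurableSet_Icc] at hvol
  have h0 : volume (Set.Icc (1 : ℝ) 2) = 0 := by
    refine le_antisymm ?_ zero_le
    calc volume (Set.Icc (1 : ℝ) 2)
        ≤ volume {t | t ∈ Set.Icc (1 : ℝ) 2 ∧ ∑ i, c i * (1 / (t + l i)) = 0} := by
          refine measure_mono_ae ?_
          filter_upwards [hvol] with t ht hm using ⟨hm, ht hm⟩
      _ = 0 := hfin.measure_zero _
  norm_num at h0

variable {n m : Type*} [Fintype n] [DecidableEq n] [Fintype m] [DecidableEq m]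

theorem resolvent_mulVec {A : Matrix n n ℂ} (hA : A.PosSemidef) {t : ℝ} (ht : 0 < t)
    (v : n → ℂ) : (t : ℂ) • (fnC (fun x => 1 / ((t : ℂ) + x)) A *ᵥ v) +
      A *ᵥ (fnC (fun x => 1 / ((t : ℂ) + x)) A *ᵥ v) = v := by
  have h1 : (t : ℂ) • (1 : Matrix n n ℂ) + A = fnC (fun x => (t : ℂ) + x) A := by
    rw [fnC_add (fun _ => (t : ℂ)) (fun x => (x : ℂ)) hA.isHermitian, fnC_id hA.isHermitian]
    have := fnC_eq (fun _ => (t : ℂ)) hA.isHermitian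
    rw [this, ← smul_one_eq_diagonal, Matrix.mul_smul, Matrix.mul_one, Matrix.smul_mul]
    congr 2
    exact (Unitary.coe_mul_star_self hA.isHermitian.eigenvectorUnitary).symm
  have h2 : ((t : ℂ) • (1 : Matrix n n ℂ) + A) * fnC (fun x => 1 / ((t : ℂ) + x)) A = 1 := by
    rw [h1, fnC_mul _ _ hA.isHermitian, ← fnC_one hA.isHermitian]
    refine fnC_congr hA fun x hx => ?_
    have : (t : ℂ) + x ≠ 0 := by exact_mod_cast (by positivity : t + x ≠ 0)
    field_simp
  calc _ = ((t : ℂ) • (1 : Matrix n n ℂ) + A) *ᵥ (fnC (fun x => 1 / ((t : ℂ) + x)) A *ᵥ v) := by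
        rw [add_mulVec, smul_mulVec, one_mulVec]
    _ = v := by rw [mulVec_mulVec, h2, one_mulVec]

theorem star_star_dotProduct {k : Type*} [Fintype k] (x y : k → ℂ) : star (star x ⬝ᵥ y) = star y ⬝ᵥ x := by
  rw [← star_dotProduct_star, star_star]

theorem re_star_dotProduct_comm {k : Type*} [Fintype k] (x y : k → ℂ) : (star x ⬝ᵥ y).re = (star y ⬝ᵥ x).re := by
  rw [← star_star_dotProduct x y]
  simp

/-- The resolvent inequality for a contraction `U` with `U* A U ≤ B`, with the defect bounding the
distance of the resolvents. -/
theorem resolvent_gap {A : Matrix n n ℂ} {B : Matrix m m ℂ} (hA : A.PosSemidef)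
    (hB : B.PosSemidef) (U : (m → ℂ) →ₗ[ℂ] (n → ℂ)) (w : m → ℂ)
    (hU : ∀ v, (star (U v) ⬝ᵥ U v).re ≤ (star v ⬝ᵥ v).re)
    (hAB : ∀ v, (star (U v) ⬝ᵥ (A *ᵥ U v)).re ≤ (star v ⬝ᵥ (B *ᵥ v)).re)
    (hw : ∀ v, star (U v) ⬝ᵥ U w = star v ⬝ᵥ w) {t : ℝ} (ht : 0 < t) :
    t * (star (fnC (fun x => 1 / ((t : ℂ) + x)) A *ᵥ U w -
          U (fnC (fun x => 1 / ((t : ℂ) + x)) B *ᵥ w)) ⬝ᵥ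
        (fnC (fun x => 1 / ((t : ℂ) + x)) A *ᵥ U w -
          U (fnC (fun x => 1 / ((t : ℂ) + x)) B *ᵥ w))).re ≤
      (star (U w) ⬝ᵥ (fnC (fun x => 1 / ((t : ℂ) + x)) A *ᵥ U w)).re -
        (star w ⬝ᵥ (fnC (fun x => 1 / ((t : ℂ) + x)) B *ᵥ w)).re := by
  have hξ := resolvent_mulVec hA ht (U w)
  have hζ := resolvent_mulVec hB ht w
  set ξ := fnC (fun x => 1 / ((t : ℂ) + x)) A *ᵥ U w
  set ζ := fnC (fun x => 1 / ((t : ℂ) + x)) B *ᵥ w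
  have herm (x y : n → ℂ) : (star x ⬝ᵥ (A *ᵥ y)).re = (star y ⬝ᵥ (A *ᵥ x)).re := by
    rw [re_star_dotProduct_comm, star_mulVec, hA.isHermitian.eq, ← dotProduct_mulVec]
  -- Expand `⟨ξ - Uζ, (t + A)(ξ - Uζ)⟩`: the two bounds on `U` replace `⟨Uζ, (t + A)Uζ⟩` by `⟨ζ, (t
  -- + B)ζ⟩ = ⟨ζ, w⟩`, and the cross terms equal `⟨ζ, w⟩` by `hw`.
  have hd := (hA.re_dotProduct_nonneg (ξ - U ζ))
  have e1 : (star (U ζ) ⬝ᵥ U w).re = (star ζ ⬝ᵥ w).re := by rw [hw]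
  have e2 := hU ζ
  have e3 := hAB ζ
  have e4 : (star ζ ⬝ᵥ w).re = t * (star ζ ⬝ᵥ ζ).re + (star ζ ⬝ᵥ (B *ᵥ ζ)).re := by
    conv_lhs => rw [← hζ]
    rw [dotProduct_add, dotProduct_smul]
    simp
  have e5 : (star ξ ⬝ᵥ U w).re = t * (star ξ ⬝ᵥ ξ).re + (star ξ ⬝ᵥ (A *ᵥ ξ)).re := by
    conv_lhs => rw [← hξ]
    rw [dotProduct_add, dotProduct_smul]
    simp
  have e6 : (star (U ζ) ⬝ᵥ U w).re = t * (star (U ζ) ⬝ᵥ ξ).re + (star (U ζ) ⬝ᵥ (A *ᵥ ξ)).re := by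
    conv_lhs => rw [← hξ]
    rw [dotProduct_add, dotProduct_smul]
    simp
  have e7 := re_star_dotProduct_comm ξ (U ζ)
  have e8 := herm ξ (U ζ)
  rw [re_star_dotProduct_comm (U w), re_star_dotProduct_comm w]
  simp only [star_sub, mulVec_sub, sub_dotProduct, dotProduct_sub, Complex.sub_re, map_sub,
    RCLike.re_to_complex] at hd ⊢
  nlinarith

theorem re_star_dotProduct_fnC (g : ℝ → ℝ) {A : Matrix n n ℂ} (hA : A.IsHermitian) (v : n → ℂ) :
    star v ⬝ᵥ (fnC (fun x => (g x : ℂ)) A *ᵥ v) = ((∑ i, Complex.normSq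
      ((star (hA.eigenvectorUnitary : Matrix n n ℂ) *ᵥ v) i) * g (hA.eigenvalues i) : ℝ) : ℂ) := by
  rw [star_dotProduct_fnC _ hA]
  push_cast
  exact Finset.sum_congr rfl fun i _ => mul_comm _ _

/-- `mpow A 0` projects onto the range, so such a `v` has no component in the kernel. This gives
weight zero to the eigenvalue `0`, where `f` is not controlled. -/
theorem normSq_eq_zero_of_mpow_zero {A : Matrix n n ℂ} (hA : A.IsHermitian) {v : n → ℂ}
    (hv : mpow A 0 *ᵥ v = v) (i : n) (hi : hA.eigenvalues i = 0) :
    Complex.normSq ((star (hA.eigenvectorUnitary : Matrix n n ℂ) *ᵥ v) i) = 0 := by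
  rw [Complex.normSq_eq_zero]
  conv_lhs => rw [← hv, mpow, fnC_eq _ hA]
  rw [mulVec_mulVec, Matrix.mul_assoc, ← Matrix.mul_assoc, Unitary.coe_star_mul_self,
    Matrix.one_mul, ← mulVec_mulVec, mulVec_diagonal, if_pos hi, zero_mul]

/-- On the range of `A` the value `g(0)` plays no role. -/
theorem fnC_mulVec_of_mpow_zero (g : ℝ → ℂ) {A : Matrix n n ℂ} (hA : A.IsHermitian) {v : n → ℂ}
    (hv : mpow A 0 *ᵥ v = v) :
    fnC g A *ᵥ v = fnC (fun x => if x = 0 then 0 else g x) A *ᵥ v := by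
  conv_lhs => rw [← hv, mpow, mulVec_mulVec, fnC_mul _ _ hA]
  congr 2
  funext x
  simp

/-- The equality case of the monotonicity of `v ↦ ⟪v, f(A) v⟫` under a contraction, for vectors in
the range of the operators. -/
theorem IsRegularFn.dotProduct_eq_iff {f : ℝ → ℝ} (hf : IsRegularFn f) {A : Matrix n n ℂ}
    {B : Matrix m m ℂ} (hA : A.PosSemidef)
    (hB : B.PosSemidef) (U : (m → ℂ) →ₗ[ℂ] (n → ℂ)) (w : m → ℂ)
    (hU : ∀ v, (star (U v) ⬝ᵥ U v).re ≤ (star v ⬝ᵥ v).re)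
    (hAB : ∀ v, (star (U v) ⬝ᵥ (A *ᵥ U v)).re ≤ (star v ⬝ᵥ (B *ᵥ v)).re)
    (hw : ∀ v, star (U v) ⬝ᵥ U w = star v ⬝ᵥ w)
    (hA0 : mpow A 0 *ᵥ U w = U w) (hB0 : mpow B 0 *ᵥ w = w) :
    star (U w) ⬝ᵥ (cfc f A *ᵥ U w) = star w ⬝ᵥ (cfc f B *ᵥ w) ↔
      ∀ β : ℂ, mpow A β *ᵥ U w = U (mpow B β *ᵥ w) := by
  rw [cfc_eq_fnC, cfc_eq_fnC]
  obtain ⟨x, hx⟩ := exists_fnC_mulVec_eq_sum hA.isHermitian (U w)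
  obtain ⟨y, hy⟩ := exists_fnC_mulVec_eq_sum hB.isHermitian w
  -- The spectra of `A` and `B` are joined, with signed weights on the union, so that a difference
  -- of two functional calculi becomes a single functional of `g`.
  let l : n ⊕ m → ℝ := Sum.elim hA.isHermitian.eigenvalues hB.isHermitian.eigenvalues
  have hl : ∀ i, 0 ≤ l i := by
    rintro (i | i)
    · exact hA.eigenvalues_nonneg i
    · exact hB.eigenvalues_nonneg i
  let c (k : n) : n ⊕ m → ℂ := Sum.elim (fun i => x i k) (fun j => -U (y j) k)
  have hL (g : ℝ → ℂ) (k : n) :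
      (fnC g A *ᵥ U w - U (fnC g B *ᵥ w)) k = ∑ i, c k i * g (l i) := by
    rw [hx, hy, map_sum, Fintype.sum_sum_type]
    simp [c, l, mul_comm, sub_eq_add_neg]
  constructor
  · intro heq β
    let p : n ⊕ m → ℝ := Sum.elim
      (fun i => Complex.normSq
        ((star (hA.isHermitian.eigenvectorUnitary : Matrix n n ℂ) *ᵥ U w) i))
      (fun i => -Complex.normSq
        ((star (hB.isHermitian.eigenvectorUnitary : Matrix m m ℂ) *ᵥ w) i))
    have hp (g : ℝ → ℝ) : ((∑ i, p i * g (l i) : ℝ) : ℂ) =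
        star (U w) ⬝ᵥ (fnC (fun x => (g x : ℂ)) A *ᵥ U w) -
          star w ⬝ᵥ (fnC (fun x => (g x : ℂ)) B *ᵥ w) := by
      rw [re_star_dotProduct_fnC g hA.isHermitian, re_star_dotProduct_fnC g hB.isHermitian,
        Fintype.sum_sum_type]
      simp [p, l, sub_eq_add_neg]
    have hgap (t : ℝ) (ht : 0 < t) : t * (star (fnC (fun x => 1 / ((t : ℂ) + x)) A *ᵥ U w -
          U (fnC (fun x => 1 / ((t : ℂ) + x)) B *ᵥ w)) ⬝ᵥ
        (fnC (fun x => 1 / ((t : ℂ) + x)) A *ᵥ U w -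
          U (fnC (fun x => 1 / ((t : ℂ) + x)) B *ᵥ w))).re ≤ ∑ i, p i * (1 / (t + l i)) := by
      have h1 := resolvent_gap hA hB U w hU hAB hw ht
      have h2 := congrArg Complex.re (hp fun x => 1 / (t + x))
      rw [Complex.ofReal_re, Complex.sub_re] at h2
      push_cast at h2
      rwa [← h2] at h1
    obtain ⟨s, hs, hs0⟩ := hf.exists_infinite_resolvent p l hl
      (by
        rintro (i | i) hi
        · exact normSq_eq_zero_of_mpow_zero hA.isHermitian hA0 i hi
        · exact neg_eq_zero.mpr (normSq_eq_zero_of_mpow_zero hB.isHermitian hB0 i hi))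
      (by
        have := hp fun _ => 1
        simp only [mul_one, Complex.ofReal_one, fnC_one hA.isHermitian, fnC_one hB.isHermitian,
          one_mulVec, hw, sub_self] at this
        exact_mod_cast this)
      (by
        have := congrArg Complex.re (hp fun x => x)
        rw [Complex.ofReal_re, Complex.sub_re, fnC_id hA.isHermitian, fnC_id hB.isHermitian] at this
        rw [this]
        exact sub_nonpos.mpr (hAB w))
      (fun t ht => by
        refine le_trans (mul_nonneg ht.le ?_) (hgap t ht)
        exact (Complex.nonneg_iff.mp (dotProduct_star_self_nonneg _)).1)
      (by
        have := hp f
        rw [heq, sub_self] at this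
        exact_mod_cast this)
    have hres : ∀ t ∈ s, fnC (fun x => 1 / ((t : ℂ) + x)) A *ᵥ U w -
          U (fnC (fun x => 1 / ((t : ℂ) + x)) B *ᵥ w) = 0 := by
      intro t ht
      obtain ⟨ht0, hts⟩ := hs0 t ht
      have h1 := hgap t ht0
      rw [hts] at h1
      have h2 := Complex.nonneg_iff.mp (dotProduct_star_self_nonneg
        (fnC (fun x => 1 / ((t : ℂ) + x)) A *ᵥ U w -
          U (fnC (fun x => 1 / ((t : ℂ) + x)) B *ᵥ w)))
      rw [← dotProduct_star_self_eq_zero]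
      exact Complex.ext (le_antisymm (nonpos_of_mul_nonpos_right h1 ht0) h2.1) h2.2.symm
    refine sub_eq_zero.mp (funext fun k => ?_)
    rw [mpow, mpow, hL]
    refine sum_mul_eq_zero_of_resolvents (c k) l hl s hs (fun t ht => (hs0 t ht).1)
      (fun t ht => ?_) fun x => if x = 0 then 0 else (x : ℂ) ^ β
    rw [← hL fun x => 1 / ((t : ℂ) + x), hres t ht]
    rfl
  · intro h
    let g : ℝ → ℂ := fun x => if x = 0 then 0 else (f x : ℂ)
    have hg : fnC g A *ᵥ U w = U (fnC g B *ᵥ w) := by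
      refine sub_eq_zero.mp (funext fun k => ?_)
      rw [hL]
      -- Natural exponents `β` suffice here.
      refine sum_mul_eq_zero_of_powers (c k) l (fun j => ?_) fun x => (f x : ℂ)
      have := hL (fun x => if x = 0 then 0 else (x : ℂ) ^ (j : ℂ)) k
      have h' := h j
      rw [mpow, mpow] at h'
      rw [h', sub_self] at this
      simpa using this.symm
    rw [fnC_mulVec_of_mpow_zero _ hA.isHermitian hA0, fnC_mulVec_of_mpow_zero _ hB.isHermitian hB0,
      hg]
    have := congrArg star (hw (fnC g B *ᵥ w))
    rwa [star_star_dotProduct, star_star_dotProduct] at this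

end Equality

/-! ### Complex powers of positive semidefinite matrices. -/

section Powers

variable {n : Type*} [Fintype n] [DecidableEq n] {A B : Matrix n n ℂ}

theorem mpow_mul (hA : A.IsHermitian) (α β : ℂ) : mpow A α * mpow A β = mpow A (α + β) := by
  rw [mpow, mpow, mpow, fnC_mul _ _ hA]
  congr 1
  funext x
  by_cases h : x = 0
  · simp [h]
  · simp [h, Complex.cpow_add _ _ (Complex.ofReal_ne_zero.mpr h)]

theorem mpow_one (hA : A.IsHermitian) : mpow A 1 = A := by
  conv_rhs => rw [← fnC_id hA]
  rw [mpow]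
  congr 1
  funext x
  by_cases h : x = 0 <;> simp [h]

theorem mpow_zero_mul_self (hA : A.IsHermitian) : mpow A 0 * A = A := by
  have h := mpow_mul hA 0 1
  rwa [zero_add, mpow_one hA] at h

theorem self_mul_mpow (hA : A.IsHermitian) (β : ℂ) : A * mpow A β = mpow A (1 + β) := by
  rw [← mpow_mul hA, mpow_one hA]

theorem mpow_half_mul_self (hA : A.IsHermitian) : mpow A (1 / 2) * mpow A (1 / 2) = A := by
  rw [mpow_mul hA, add_halves, mpow_one hA]

theorem isHermitian_mpow (hA : A.PosSemidef) (r : ℝ) : (mpow A r).IsHermitian := by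
  rw [IsHermitian, mpow, fnC_conjTranspose _ hA.isHermitian]
  refine fnC_congr hA fun x hx => ?_
  by_cases h : x = 0
  · simp [h]
  · simp [h, ← Complex.ofReal_cpow hx]

theorem isHermitian_mpow_half (hA : A.PosSemidef) : (mpow A (1 / 2)).IsHermitian := by
  simpa using isHermitian_mpow hA (1 / 2)

theorem isHermitian_mpow_zero (hA : A.PosSemidef) : (mpow A 0).IsHermitian := by
  simpa using isHermitian_mpow hA 0

theorem posSemidef_one_sub_mpow_zero (hA : A.PosSemidef) : (1 - mpow A 0).PosSemidef := by
  have h : (1 - mpow A 0)ᴴ * (1 - mpow A 0) = 1 - mpow A 0 := by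
    rw [conjTranspose_sub, conjTranspose_one, (isHermitian_mpow_zero hA).eq]
    simp [Matrix.mul_sub, Matrix.sub_mul, mpow_mul hA.isHermitian]
  rw [← h]
  exact posSemidef_conjTranspose_mul_self _

theorem mpow_zero_of_posDef (hA : A.PosDef) : mpow A 0 = 1 := by
  rw [mpow, fnC_eq _ hA.isHermitian]
  simp only [(hA.eigenvalues_pos _).ne', if_false, Complex.cpow_zero, diagonal_one,
    Matrix.mul_one]
  exact Unitary.coe_mul_star_self _

/-- Complex powers of `A ⊗ (B⁻¹)ᵀ`, the matrix of the modular operator. -/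
theorem mpow_kronecker_transpose (hA : A.PosSemidef) (hB : B.PosSemidef) (β : ℂ) :
    mpow (A ⊗ₖ (mpow B (-1))ᵀ) β = mpow A β ⊗ₖ (mpow B (-β))ᵀ := by
  set W := (hA.isHermitian.eigenvectorUnitary : Matrix n n ℂ) with hW
  set Z := (hB.isHermitian.eigenvectorUnitary : Matrix n n ℂ) with hZ
  have hWW : star W * W = 1 := Unitary.coe_star_mul_self _
  have hWW' : W * star W = 1 := Unitary.coe_mul_star_self _
  have hZZ : star Z * Z = 1 := Unitary.coe_star_mul_self _
  have hZZ' : Z * star Z = 1 := Unitary.coe_mul_star_self _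
  set a := hA.isHermitian.eigenvalues with ha
  set b := hB.isHermitian.eigenvalues with hb
  -- Transposing `B = Z b Z*` gives `Bᵀ = (Z*)ᵀ b Zᵀ`, so the columns of `X` are joint eigenvectors
  -- of both tensor factors.
  set X : Matrix (n × n) (n × n) ℂ := W ⊗ₖ (star Z)ᵀ with hX
  have hXX : X * (star W ⊗ₖ Zᵀ) = 1 := by
    rw [hX, ← mul_kronecker_mul, hWW', ← transpose_mul, hZZ', transpose_one, one_kronecker_one]
  have key (g h : ℝ → ℂ) : (fnC g A ⊗ₖ (fnC h B)ᵀ) * X =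
      X * diagonal fun p : n × n => g (a p.1) * h (b p.2) := by
    rw [← diagonal_kronecker_diagonal (fun i => g (a i)) (fun j => h (b j)), hX,
      ← mul_kronecker_mul, ← mul_kronecker_mul, ← transpose_mul, fnC_eq g hA.isHermitian,
      fnC_eq h hB.isHermitian, ← hW, ← hZ, Matrix.mul_assoc _ (star W) W, hWW, Matrix.mul_one,
      ← Matrix.mul_assoc (star Z), ← Matrix.mul_assoc (star Z), hZZ, Matrix.one_mul,
      transpose_mul, diagonal_transpose]
  have hD : (diagonal fun p : n × n => ((a p.1 * (b p.2)⁻¹ : ℝ) : ℂ)).IsHermitian := by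
    rw [IsHermitian, diagonal_conjTranspose]
    congr 1
    funext i
    simp
  have hM : (A ⊗ₖ (mpow B (-1))ᵀ).IsHermitian := by
    have : (mpow B (-1)).IsHermitian := by simpa using isHermitian_mpow hB (-1)
    rw [IsHermitian, conjTranspose_kronecker, hA.isHermitian.eq, this.transpose.eq]
  have h1 : (A ⊗ₖ (mpow B (-1))ᵀ) * X =
      X * diagonal fun p : n × n => ((a p.1 * (b p.2)⁻¹ : ℝ) : ℂ) := by
    have := key (fun x => x) (fun x => if x = 0 then 0 else (x : ℂ) ^ (-1 : ℂ))
    rw [fnC_id hA.isHermitian] at this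
    rw [mpow, this]
    congr 2
    funext p
    by_cases h : b p.2 = 0
    · simp [h]
    · simp [h, Complex.cpow_neg_one]
  have h2 := fnC_intertwine (fun x => if x = 0 then 0 else (x : ℂ) ^ β) hM hD X h1
  rw [fnC_diagonal] at h2
  have h3 := key (fun x => if x = 0 then 0 else (x : ℂ) ^ β)
    (fun x => if x = 0 then 0 else (x : ℂ) ^ (-β))
  have h4 : mpow (A ⊗ₖ (mpow B (-1))ᵀ) β * X = (mpow A β ⊗ₖ (mpow B (-β))ᵀ) * X := by
    rw [mpow, h2, mpow, mpow, h3]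
    congr 2
    funext p
    have ha0 : 0 ≤ a p.1 := hA.eigenvalues_nonneg _
    have hb0 : 0 ≤ b p.2 := hB.eigenvalues_nonneg _
    by_cases h : b p.2 = 0
    · simp [h]
    by_cases h' : a p.1 = 0
    · simp [h']
    -- `(a b⁻¹)^β` factors without branch problems because `a` and `b` are nonnegative.
    rw [if_neg (mul_ne_zero h' (inv_ne_zero h)), if_neg h, if_neg h', Complex.ofReal_mul,
      Complex.mul_cpow_ofReal_nonneg ha0 (inv_nonneg.mpr hb0), Complex.ofReal_inv,
      Complex.inv_cpow _ _ (by rw [Complex.arg_ofReal_of_nonneg hb0]; exact Real.pi_pos.ne),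
      Complex.cpow_neg]
  have h5 := congrArg (· * (star W ⊗ₖ Zᵀ)) h4
  simpa only [Matrix.mul_assoc, hXX, Matrix.mul_one] using h5

end Powers

/-! ### Hilbert–Schmidt space as coordinate space. -/

section Vectorization

variable {n : Type*} [Fintype n] [DecidableEq n]

/-- The row-major vectorization of a matrix: its coordinates in the matrix units. -/
noncomputable def rowVec : Matrix n n ℂ ≃ₗ[ℂ] (n × n → ℂ) :=
  (Matrix.stdBasis ℂ n n).equivFun

theorem rowVec_apply (X : Matrix n n ℂ) (p : n × n) : rowVec X p = X p.1 p.2 := by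
  have h : rowVec.symm (fun p : n × n => X p.1 p.2) = X := by
    rw [rowVec, Module.Basis.equivFun_symm_apply]
    ext i j
    simp [Matrix.sum_apply, Matrix.stdBasis_eq_single, Matrix.single_apply,
      Fintype.sum_prod_type, ite_and]
  conv_lhs => rw [← h]
  rw [LinearEquiv.apply_symm_apply]

theorem star_rowVec_dotProduct (X Y : Matrix n n ℂ) :
    star (rowVec X) ⬝ᵥ rowVec Y = (Xᴴ * Y).trace := by
  rw [dotProduct, Fintype.sum_prod_type, Finset.sum_comm]
  simp [rowVec_apply, Matrix.trace, Matrix.mul_apply]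

theorem kronecker_transpose_mulVec_rowVec (A B X : Matrix n n ℂ) :
    (A ⊗ₖ Bᵀ) *ᵥ rowVec X = rowVec (A * X * B) := by
  ext ⟨i, j⟩
  simp only [mulVec, dotProduct, Fintype.sum_prod_type, rowVec_apply, kroneckerMap_apply,
    transpose_apply, Matrix.mul_apply, Finset.sum_mul]
  rw [Finset.sum_comm]
  exact Finset.sum_congr rfl fun _ _ => Finset.sum_congr rfl fun _ _ => by ring

theorem toMatrix_modularOp (A B : Matrix n n ℂ) :
    LinearMap.toMatrix (Matrix.stdBasis ℂ n n) (Matrix.stdBasis ℂ n n) (modularOp A B) =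
      A ⊗ₖ (mpow B (-1))ᵀ := by
  ext ⟨i, j⟩ ⟨k, l⟩
  rw [LinearMap.toMatrix_apply, Matrix.stdBasis_eq_single, kroneckerMap_apply, transpose_apply]
  simp [modularOp, Matrix.stdBasis, Matrix.mul_apply, Matrix.single_apply, ite_and]

theorem posSemidef_kronecker_transpose {A B : Matrix n n ℂ} (hA : A.PosSemidef)
    (hB : B.PosSemidef) : (A ⊗ₖ (mpow B (-1))ᵀ).PosSemidef :=
  toMatrix_modularOp A B ▸ posSemidef_toMatrix_modularOp hA hB

theorem quasiEntropy_eq_dotProduct (f : ℝ → ℝ) (K : Matrix n n ℂ) {ρ : Matrix n n ℂ}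
    (hρ : ρ.PosSemidef) (σ : Matrix n n ℂ) :
    quasiEntropy f K ρ σ = star (rowVec (K * mpow ρ (1 / 2))) ⬝ᵥ
      (cfc f (σ ⊗ₖ (mpow ρ (-1))ᵀ) *ᵥ rowVec (K * mpow ρ (1 / 2))) := by
  have h : cfc f (σ ⊗ₖ (mpow ρ (-1))ᵀ) *ᵥ rowVec (K * mpow ρ (1 / 2)) =
      rowVec (superFn f (modularOp σ ρ) (K * mpow ρ (1 / 2))) := by
    rw [superFn, toMatrix_modularOp]
    conv_lhs => rw [← LinearMap.toMatrix_toLin (Matrix.stdBasis ℂ n n) (Matrix.stdBasis ℂ n n)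
      (cfc f (σ ⊗ₖ (mpow ρ (-1))ᵀ))]
    exact LinearMap.toMatrix_mulVec_repr _ _ _ _
  rw [h, star_rowVec_dotProduct, conjTranspose_mul, (isHermitian_mpow_half hρ).eq, quasiEntropy]

end Vectorization

/-! ### Partial trace and the contraction between the two Hilbert–Schmidt spaces. -/

section PartialTrace

theorem posSemidef_ptrace₂ {m n : Type*} [Fintype n] {X : Matrix (m × n) (m × n) ℂ} (hX : X.PosSemidef) :
    (ptrace₂ X).PosSemidef := by
  have h : ptrace₂ X = ∑ k, X.submatrix (fun i => (i, k)) (fun i => (i, k)) := by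
    ext i j
    simp [ptrace₂, Matrix.sum_apply]
  rw [h]
  exact posSemidef_sum _ fun k _ => hX.submatrix _

/-- Partial trace is dual to `A ↦ A ⊗ 1`; comparisons of `ρ`, `σ` with their marginals rest on this.
-/
theorem trace_mul_kronecker_one {m n : Type*} [Fintype m] [Fintype n] [DecidableEq n]
    (X : Matrix (m × n) (m × n) ℂ) (A : Matrix m m ℂ) :
    (X * (A ⊗ₖ (1 : Matrix n n ℂ))).trace = (ptrace₂ X * A).trace := by
  simp only [Matrix.trace, diag_apply, Matrix.mul_apply, Fintype.sum_prod_type, ptrace₂, of_apply,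
    kroneckerMap_apply, Matrix.one_apply, mul_ite, mul_one, mul_zero, Finset.sum_ite_eq',
    Finset.mem_univ, if_true, Finset.sum_mul]
  exact Finset.sum_congr rfl fun _ _ => Finset.sum_comm

variable {m n : Type*} [Fintype m] [DecidableEq m] [Fintype n] [DecidableEq n]
  {ρ σ : Matrix (m × n) (m × n) ℂ} {V : Matrix n n ℂ}

theorem trace_mul_sqrt {k : Type*} [Fintype k] [DecidableEq k] {R : Matrix k k ℂ}
    (hR : R.PosSemidef) (A B : Matrix k k ℂ) :
    ((A * mpow R (1 / 2))ᴴ * (B * mpow R (1 / 2))).trace = (R * (Aᴴ * B)).trace := by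
  rw [← Matrix.mul_assoc, trace_mul_comm, conjTranspose_mul, (isHermitian_mpow_half hR).eq,
    ← Matrix.mul_assoc, ← Matrix.mul_assoc, mpow_half_mul_self hR.isHermitian, Matrix.mul_assoc]

/-- `V*V = 1` leaves `A*B ⊗ 1` under the trace against `ρ`, which sees only `ρ₁`. This is why `U`
preserves inner products on the range of `ρ₁`. -/
theorem trace_kronecker_sqrt (hρ : ρ.PosSemidef) (hV : V ∈ Matrix.unitaryGroup n ℂ)
    (A B : Matrix m m ℂ) :
    (((A ⊗ₖ V) * mpow ρ (1 / 2))ᴴ * ((B ⊗ₖ V) * mpow ρ (1 / 2))).trace =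
      ((A * mpow (ptrace₂ ρ) (1 / 2))ᴴ * (B * mpow (ptrace₂ ρ) (1 / 2))).trace := by
  have hV' : Vᴴ * V = 1 := mem_unitaryGroup_iff'.mp hV
  rw [trace_mul_sqrt hρ, trace_mul_sqrt (posSemidef_ptrace₂ hρ), ← trace_mul_kronecker_one, conjTranspose_kronecker,
    ← mul_kronecker_mul, hV']

theorem kronecker_mul_sqrt_eq_zero_iff (hρ : ρ.PosSemidef) (hV : V ∈ Matrix.unitaryGroup n ℂ)
    (A : Matrix m m ℂ) :
    (A ⊗ₖ V) * mpow ρ (1 / 2) = 0 ↔ A * mpow (ptrace₂ ρ) (1 / 2) = 0 := by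
  rw [← trace_conjTranspose_mul_self_eq_zero_iff, trace_kronecker_sqrt hρ hV,
    trace_conjTranspose_mul_self_eq_zero_iff]

/-- The support of `ρ` lies in that of `ρ₁ ⊗ 1`: the difference of the two sides vanishes because
`(Aρ₁⁰ - A)ρ₁^{1/2} = 0`. -/
theorem mul_mpow_zero_kronecker_mul_sqrt (hρ : ρ.PosSemidef)
    (hV : V ∈ Matrix.unitaryGroup n ℂ) (A : Matrix m m ℂ) :
    ((A * mpow (ptrace₂ ρ) 0) ⊗ₖ V) * mpow ρ (1 / 2) = (A ⊗ₖ V) * mpow ρ (1 / 2) := by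
  have hsub : (A * mpow (ptrace₂ ρ) 0) ⊗ₖ V - A ⊗ₖ V = (A * mpow (ptrace₂ ρ) 0 - A) ⊗ₖ V := by
    ext
    simp [sub_mul]
  rw [← sub_eq_zero, ← Matrix.sub_mul, hsub, kronecker_mul_sqrt_eq_zero_iff hρ hV,
    Matrix.sub_mul, Matrix.mul_assoc, mpow_mul (posSemidef_ptrace₂ hρ).isHermitian, zero_add,
    sub_self]

/-- The contraction `X ↦ (X ρ₁^{-1/2} ⊗ V) ρ^{1/2}` of the Hilbert–Schmidt spaces, which
intertwines the purifications of `ρ₁` and `ρ`. -/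
noncomputable def purificationMap (ρ : Matrix (m × n) (m × n) ℂ) (V : Matrix n n ℂ) :
    Matrix m m ℂ →ₗ[ℂ] Matrix (m × n) (m × n) ℂ where
  toFun X := ((X * mpow (ptrace₂ ρ) (-(1 / 2))) ⊗ₖ V) * mpow ρ (1 / 2)
  map_add' X Y := by rw [Matrix.add_mul, add_kronecker, Matrix.add_mul]
  map_smul' c X := by
    rw [Matrix.smul_mul, smul_kronecker, Matrix.smul_mul, RingHom.id_apply]

theorem purificationMap_mul_mpow (hρ : ρ.PosSemidef) (A : Matrix m m ℂ) (β : ℂ) :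
    purificationMap ρ V (A * mpow (ptrace₂ ρ) (1 / 2) * mpow (ptrace₂ ρ) β) =
      ((A * mpow (ptrace₂ ρ) β) ⊗ₖ V) * mpow ρ (1 / 2) := by
  have h := (posSemidef_ptrace₂ hρ).isHermitian
  simp only [purificationMap, LinearMap.coe_mk, AddHom.coe_mk]
  rw [Matrix.mul_assoc, Matrix.mul_assoc, mpow_mul h, mpow_mul h]
  ring_nf

/-- `ρ₁^{-1/2}ρ₁^{1/2} = ρ₁⁰`, so the map is a partial isometry whose initial projection is `X ↦
Xρ₁⁰`. -/
theorem trace_purificationMap (hρ : ρ.PosSemidef) (hV : V ∈ Matrix.unitaryGroup n ℂ)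
    (X Y : Matrix m m ℂ) :
    ((purificationMap ρ V X)ᴴ * purificationMap ρ V Y).trace =
      ((X * mpow (ptrace₂ ρ) 0)ᴴ * (Y * mpow (ptrace₂ ρ) 0)).trace := by
  simp only [purificationMap, LinearMap.coe_mk, AddHom.coe_mk]
  rw [trace_kronecker_sqrt hρ hV]
  simp only [Matrix.mul_assoc, mpow_mul (posSemidef_ptrace₂ hρ).isHermitian, neg_add_cancel]

theorem re_trace_mul_mpow_zero_le {k : Type*} [Fintype k] [DecidableEq k] {R Y : Matrix k k ℂ}
    (hR : R.PosSemidef) (hY : Y.PosSemidef) : (Y * mpow R 0).trace.re ≤ Y.trace.re := by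
  -- The trace lost is that of the compression of `Y` to the kernel of `R`, which is nonnegative.
  have h1 : (((1 - mpow R 0)ᴴ * Y * (1 - mpow R 0))).trace = Y.trace - (Y * mpow R 0).trace := by
    have hQ := posSemidef_one_sub_mpow_zero hR
    have hQ2 : (1 - mpow R 0) * (1 - mpow R 0) = 1 - mpow R 0 := by
      simp [Matrix.mul_sub, Matrix.sub_mul, mpow_mul hR.isHermitian]
    rw [hQ.isHermitian.eq, trace_mul_comm, ← Matrix.mul_assoc, hQ2, trace_mul_comm,
      Matrix.mul_sub, Matrix.mul_one, trace_sub]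
  have h2 := (Complex.nonneg_iff.mp (hY.conjTranspose_mul_mul_same (1 - mpow R 0)).trace_nonneg).1
  rw [h1, Complex.sub_re] at h2
  linarith

theorem re_trace_purificationMap_le (hρ : ρ.PosSemidef) (hV : V ∈ Matrix.unitaryGroup n ℂ)
    (X : Matrix m m ℂ) :
    ((purificationMap ρ V X)ᴴ * purificationMap ρ V X).trace.re ≤ (Xᴴ * X).trace.re := by
  have h := posSemidef_ptrace₂ hρ
  rw [trace_purificationMap hρ hV, conjTranspose_mul, (isHermitian_mpow_zero h).eq,
    trace_mul_comm, Matrix.mul_assoc, ← Matrix.mul_assoc (mpow _ _), mpow_mul h.isHermitian,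
    zero_add, ← Matrix.mul_assoc, trace_mul_comm, ← Matrix.mul_assoc]
  exact re_trace_mul_mpow_zero_le h (posSemidef_conjTranspose_mul_self X)

/-- With `Y = Xρ₁^{-1/2} ⊗ V`, the relation `VV* = 1` reduces `Tr Y*σY` exactly to the right-hand
side. The left-hand side carries the extra projection `ρ⁰`, the only source of inequality. -/
theorem re_trace_modular_purificationMap_le (hρ : ρ.PosSemidef) (hσ : σ.PosSemidef)
    (hV : V ∈ Matrix.unitaryGroup n ℂ) (X : Matrix m m ℂ) :
    ((purificationMap ρ V X)ᴴ * (σ * purificationMap ρ V X * mpow ρ (-1))).trace.re ≤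
      (Xᴴ * (ptrace₂ σ * X * mpow (ptrace₂ ρ) (-1))).trace.re := by
  have h := posSemidef_ptrace₂ hρ
  have hV' : V * Vᴴ = 1 := mem_unitaryGroup_iff.mp hV
  have hS : (mpow (ptrace₂ ρ) (-(1 / 2))).IsHermitian := by
    simpa using isHermitian_mpow h (-(1 / 2))
  set S := mpow (ptrace₂ ρ) (-(1 / 2)) with hSdef
  set Y : Matrix (m × n) (m × n) ℂ := (X * S) ⊗ₖ V with hY
  have e1 : ((purificationMap ρ V X)ᴴ * (σ * purificationMap ρ V X * mpow ρ (-1))).trace =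
      (Yᴴ * σ * Y * mpow ρ 0).trace := by
    simp only [purificationMap, LinearMap.coe_mk, AddHom.coe_mk]
    rw [← hSdef, ← hY, conjTranspose_mul, (isHermitian_mpow_half hρ).eq, Matrix.mul_assoc,
      trace_mul_comm]
    simp only [Matrix.mul_assoc, mpow_mul hρ.isHermitian]
    norm_num
  have e2 : (Yᴴ * σ * Y).trace = (Xᴴ * (ptrace₂ σ * X * mpow (ptrace₂ ρ) (-1))).trace := by
    have hSS : S * Sᴴ = mpow (ptrace₂ ρ) (-1) := by
      rw [hS.eq, mpow_mul h.isHermitian]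
      norm_num
    rw [Matrix.mul_assoc, trace_mul_comm, Matrix.mul_assoc, hY, conjTranspose_kronecker,
      ← mul_kronecker_mul, hV', trace_mul_kronecker_one, conjTranspose_mul, trace_mul_comm (Xᴴ),
      Matrix.mul_assoc X, ← Matrix.mul_assoc S, hSS]
    simp only [Matrix.mul_assoc]
  rw [e1, ← e2]
  exact re_trace_mul_mpow_zero_le hρ (hσ.conjTranspose_mul_mul_same Y)

/-- If `K` maps the range of `ρ` into the range of `σ`, then so does `K ρ^{1/2}`. -/
theorem mpow_zero_mul_mul_sqrt {k : Type*} [Fintype k] [DecidableEq k] {ρ σ K : Matrix k k ℂ}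
    (hρ : ρ.PosSemidef) (hσ : σ.PosSemidef)
    (hsupp : LinearMap.range (K * ρ).mulVecLin ≤ LinearMap.range σ.mulVecLin) :
    mpow σ 0 * (K * mpow ρ (1 / 2)) = K * mpow ρ (1 / 2) := by
  have h1 : mpow σ 0 * (K * ρ) = K * ρ := by
    refine Matrix.ext_of_mulVec_single fun i => ?_
    obtain ⟨y, hy⟩ := hsupp ⟨Pi.single i 1, rfl⟩
    rw [mulVecLin_apply, mulVecLin_apply] at hy
    rw [← mulVec_mulVec, ← hy, mulVec_mulVec]
    rw [mpow_zero_mul_self hσ.isHermitian]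
  have h2 : ρ * mpow ρ (-(1 / 2)) = mpow ρ (1 / 2) := by
    rw [self_mul_mpow hρ.isHermitian]
    norm_num
  rw [← h2, ← Matrix.mul_assoc K, ← Matrix.mul_assoc, h1]

/-- If `(K₁ ⊗ V) ρ^{1/2}` is in the range of `σ`, then `K₁ ρ₁^{1/2}` is in the range of `σ₁`. -/
theorem mpow_zero_ptrace₂_mul_mul_sqrt {K₁ : Matrix m m ℂ} (hρ : ρ.PosSemidef)
    (hσ : σ.PosSemidef) (hV : V ∈ Matrix.unitaryGroup n ℂ)
    (h : mpow σ 0 * ((K₁ ⊗ₖ V) * mpow ρ (1 / 2)) = (K₁ ⊗ₖ V) * mpow ρ (1 / 2)) :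
    mpow (ptrace₂ σ) 0 * (K₁ * mpow (ptrace₂ ρ) (1 / 2)) = K₁ * mpow (ptrace₂ ρ) (1 / 2) := by
  -- `Q` kills `σ₁^{1/2}`, so `Q ⊗ 1` kills `σ^{1/2}`, hence the range of `σ` and with it `(K₁ ⊗
  -- V)ρ^{1/2}`; this descends to `QK₁ρ₁^{1/2} = 0`.
  set Q := 1 - mpow (ptrace₂ σ) 0 with hQ
  have hσ₁ := (posSemidef_ptrace₂ hσ).isHermitian
  have h1 : (Q ⊗ₖ (1 : Matrix n n ℂ)) * mpow σ (1 / 2) = 0 := by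
    rw [kronecker_mul_sqrt_eq_zero_iff hσ (one_mem _), hQ, Matrix.sub_mul, Matrix.one_mul,
      mpow_mul hσ₁, zero_add, sub_self]
  have h2 : (Q ⊗ₖ (1 : Matrix n n ℂ)) * mpow σ 0 = 0 := by
    rw [← add_neg_cancel (1 / 2 : ℂ), ← mpow_mul hσ.isHermitian, ← Matrix.mul_assoc, h1,
      Matrix.zero_mul]
  have h3 : ((Q * K₁) ⊗ₖ V) * mpow ρ (1 / 2) = 0 := by
    rw [← Matrix.one_mul V, mul_kronecker_mul, Matrix.mul_assoc, ← h,
      ← Matrix.mul_assoc, h2, Matrix.zero_mul]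
  rw [kronecker_mul_sqrt_eq_zero_iff hρ hV, hQ, Matrix.sub_mul, Matrix.one_mul, Matrix.sub_mul,
    sub_eq_zero, Matrix.mul_assoc] at h3
  exact h3.symm

/-- Equality in the monotonicity of the quasi-entropy under the partial trace. -/
theorem IsRegularFn.quasiEntropy_eq_iff {f : ℝ → ℝ} (hf : IsRegularFn f) (hρ : ρ.PosSemidef)
    (hσ : σ.PosSemidef) (K₁ : Matrix m m ℂ) (hV : V ∈ Matrix.unitaryGroup n ℂ)
    (h : mpow σ 0 * ((K₁ ⊗ₖ V) * mpow ρ (1 / 2)) = (K₁ ⊗ₖ V) * mpow ρ (1 / 2)) :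
    quasiEntropy f (K₁ ⊗ₖ V) ρ σ = quasiEntropy f K₁ (ptrace₂ ρ) (ptrace₂ σ) ↔
      ∀ β : ℂ,
        (mpow (ptrace₂ σ) β ⊗ₖ (1 : Matrix n n ℂ)) * (K₁ ⊗ₖ V) *
            (mpow (ptrace₂ ρ) (-β) ⊗ₖ (1 : Matrix n n ℂ)) * mpow ρ (1 / 2) =
          mpow σ β * (K₁ ⊗ₖ V) * mpow ρ (1 / 2 - β) := by
  have hρ₁ := posSemidef_ptrace₂ hρ
  have hσ₁ := posSemidef_ptrace₂ hσ
  let U : (m × m → ℂ) →ₗ[ℂ] ((m × n) × (m × n) → ℂ) :=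
    rowVec.toLinearMap ∘ₗ purificationMap ρ V ∘ₗ rowVec.symm.toLinearMap
  have hU (X : Matrix m m ℂ) : U (rowVec X) = rowVec (purificationMap ρ V X) := by
    simp [U]
  have hsqrt : mpow (ptrace₂ ρ) (1 / 2) * mpow (ptrace₂ ρ) 0 = mpow (ptrace₂ ρ) (1 / 2) := by
    rw [mpow_mul hρ₁.isHermitian, add_zero]
  have hUw : U (rowVec (K₁ * mpow (ptrace₂ ρ) (1 / 2))) =
      rowVec ((K₁ ⊗ₖ V) * mpow ρ (1 / 2)) := by
    have := purificationMap_mul_mpow (V := V) hρ K₁ 0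
    rw [Matrix.mul_assoc, hsqrt, mul_mpow_zero_kronecker_mul_sqrt hρ hV] at this
    rw [hU, this]
  rw [quasiEntropy_eq_dotProduct f _ hρ, quasiEntropy_eq_dotProduct f _ hρ₁, ← hUw,
    hf.dotProduct_eq_iff (posSemidef_kronecker_transpose hσ hρ)
      (posSemidef_kronecker_transpose hσ₁ hρ₁) U]
  · refine forall_congr' fun β => ?_
    rw [mpow_kronecker_transpose hσ hρ, mpow_kronecker_transpose hσ₁ hρ₁, hUw,
      kronecker_transpose_mulVec_rowVec, kronecker_transpose_mulVec_rowVec, hU,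
      rowVec.injective.eq_iff, ← Matrix.mul_assoc (mpow (ptrace₂ σ) β),
      purificationMap_mul_mpow hρ, Matrix.mul_assoc (mpow σ β), Matrix.mul_assoc (K₁ ⊗ₖ V),
      mpow_mul hρ.isHermitian, ← sub_eq_add_neg, ← Matrix.mul_assoc, ← mul_kronecker_mul,
      ← mul_kronecker_mul, Matrix.one_mul, Matrix.mul_one]
    exact eq_comm
  · intro v
    obtain ⟨X, rfl⟩ := rowVec.surjective v
    rw [hU, star_rowVec_dotProduct, star_rowVec_dotProduct]
    exact re_trace_purificationMap_le hρ hV X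
  · intro v
    obtain ⟨X, rfl⟩ := rowVec.surjective v
    rw [hU, kronecker_transpose_mulVec_rowVec, kronecker_transpose_mulVec_rowVec,
      star_rowVec_dotProduct, star_rowVec_dotProduct]
    exact re_trace_modular_purificationMap_le hρ hσ hV X
  · intro v
    obtain ⟨X, rfl⟩ := rowVec.surjective v
    -- `U*Uw = w` because `w = K₁ρ₁^{1/2}` is unchanged by right multiplication with `ρ₁⁰`.
    rw [hU, hU, star_rowVec_dotProduct, star_rowVec_dotProduct, trace_purificationMap hρ hV,
      Matrix.mul_assoc K₁, hsqrt, conjTranspose_mul, (isHermitian_mpow_zero hρ₁).eq,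
      trace_mul_comm, ← Matrix.mul_assoc, Matrix.mul_assoc K₁, hsqrt, trace_mul_comm]
  · rw [mpow_kronecker_transpose hσ hρ, hUw, kronecker_transpose_mulVec_rowVec, h,
      Matrix.mul_assoc, mpow_mul hρ.isHermitian, neg_zero, add_zero]
  · rw [mpow_kronecker_transpose hσ₁ hρ₁, kronecker_transpose_mulVec_rowVec,
      mpow_zero_ptrace₂_mul_mul_sqrt hρ hσ hV h, Matrix.mul_assoc, neg_zero, hsqrt]

end PartialTrace

end QuasiEntropy

theorem corollary4p6 {m n : Type*} [Fintype m] [DecidableEq m] [Fintype n] [DecidableEq n]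
    (f : ℝ → ℝ) (hf : IsRegularFn f)
    (ρ σ : Matrix (m × n) (m × n) ℂ) (hρ : IsState ρ) (hσ : IsState σ)
    (K : Matrix (m × n) (m × n) ℂ) (K₁ : Matrix m m ℂ) (V : Matrix n n ℂ)
    (hV : V ∈ Matrix.unitaryGroup n ℂ) (hK : K = K₁ ⊗ₖ V)
    (hsupp : LinearMap.range (K * ρ).mulVecLin ≤ LinearMap.range σ.mulVecLin) :
    (ρ.PosDef →
      (quasiEntropy f K ρ σ = quasiEntropy f K₁ (ptrace₂ ρ) (ptrace₂ σ) ↔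
        ∀ β : ℂ,
          (mpow (ptrace₂ σ) β ⊗ₖ (1 : Matrix n n ℂ)) * K *
              (mpow (ptrace₂ ρ) (-β) ⊗ₖ (1 : Matrix n n ℂ)) =
            mpow σ β * K * mpow ρ (-β))) ∧
    (quasiEntropy f K ρ σ = quasiEntropy f K₁ (ptrace₂ ρ) (ptrace₂ σ) ↔
      ∀ β : ℂ,
        (mpow (ptrace₂ σ) β ⊗ₖ (1 : Matrix n n ℂ)) * K *
            (mpow (ptrace₂ ρ) (-β) ⊗ₖ (1 : Matrix n n ℂ)) * mpow ρ (1 / 2) =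
          mpow σ β * K * mpow ρ (1 / 2 - β)) := by
  subst hK
  have hiff := hf.quasiEntropy_eq_iff hρ.1 hσ.1 K₁ hV
    (mpow_zero_mul_mul_sqrt hρ.1 hσ.1 hsupp)
  refine ⟨fun hpos => hiff.trans (forall_congr' fun β => ?_), hiff⟩
  have hinv : mpow ρ (1 / 2) * mpow ρ (-(1 / 2)) = 1 := by
    rw [mpow_mul hρ.1.isHermitian, add_neg_cancel, mpow_zero_of_posDef hpos]
  -- Written as `ρ^{-β}ρ^{1/2}`, the last factor has `ρ^{1/2}` on the right, which cancels when `ρ`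
  -- is invertible.
  rw [show (1 / 2 : ℂ) - β = -β + 1 / 2 by ring, ← mpow_mul hρ.1.isHermitian, ← Matrix.mul_assoc]
  refine ⟨fun h => ?_, fun h => by rw [h]⟩
  have := congrArg (· * mpow ρ (-(1 / 2))) h
  simpa only [Matrix.mul_assoc, hinv, Matrix.mul_one] using this
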